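/- Consider classical multiplication $C=AB$ of an $m\times k$ matrix $A$ by a $k\times n$ matrix $B$. Its computational DAG has as vertices the entries $A(i,t)$ and $B(t,j)$ (the inputs) and the $mnk$ partial sums $C(i,j,t)=C(i,j,t-1)+A(i,t)B(t,j)$ (the term $C(i,j,t-1)$ being absent for $t=1$). There is an edge to each partial sum from every value it is computed from. It is executed on $p\ge 1$ processors, each with a local memory of $S$ words, according to the red-blue pebble game. At the start all entries of $A$ and $B$ are in a common slow memory and the local memories are empty. At the end all entries $C(i,j,k)$ must be in the slow memory. A processor may compute a partial sum if all its operands are in its own local memory. A value may be copied between the slow memory and a local memory (load, store) or from one local memory to another (send), and it may be deleted anywhere at no cost. No local memory may ever hold more than $S$ values. The I/O cost $Q_q$ of processor $q$ is the number of words transferred into or out of its local memory (loads, stores, words received and words sent), and its local domain $\mathcal D_q$ is the set of partial sums that it computes. Suppose that $S\ge\frac{mn+mk+nk}{p}$. Then every such execution has a processor $q$ with $$Q_q\ \ge\ \min\Big\{\frac{2mnk}{p\sqrt S}+S,\ 3\Big(\frac{mnk}{p}\Big)^{2/3}\Big\}.$$ If moreover the execution is load balanced, that is, $|\mathcal D_q|=mnk/p$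 for every $q$, then this bound holds for every processor $q$. -/

import Mathlib

/-- A computational directed acyclic graph: a vertex is one elementary operation (or an input
value), and an edge `u → v` says that operation `v` uses the result of `u`. -/
structure CDAG (V : Type*) extends Digraph V where
  acyclic : ∀ v, ¬ Relation.TransGen Adj v v

/-- The inputs of a CDAG: the vertices without parents. -/
def CDAG.inputs {V : Type*} (G : CDAG V) : Set V := {v | ∀ u, ¬ G.Adj u v}

/-- The outputs of a CDAG: the vertices without children. -/
def CDAG.outputs {V : Type*} (G : CDAG V) : Set V := {v | ∀ w, ¬ G.Adj v w}

/-- A configuration of the red-blue pebble game with `p` processors. `red q` is the set of values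
that lie in the local memory of processor `q`, and `blue` is the set of values that lie in the
common slow memory. -/
structure PebbleConfig (p : ℕ) (V : Type*) where
  red : Fin p → Set V
  blue : Set V

/-- The moves of the game. -/
inductive PebbleMove (p : ℕ) (V : Type*) where
  /-- processor `q` copies `v` from the slow memory into its local memory -/
  | load (q : Fin p) (v : V)
  /-- processor `q` copies `v` from its local memory into the slow memory -/
  | store (q : Fin p) (v : V)
  /-- the value `v` is copied from the local memory of `q` into that of `r` -/
  | send (q r : Fin p) (v : V)
  /-- processor `q` performs the operation `v` -/
  | compute (q : Fin p) (v : V)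
  /-- processor `q` deletes `v` from its local memory -/
  | freeRed (q : Fin p) (v : V)
  /-- `v` is deleted from the slow memory -/
  | freeBlue (v : V)

/-- `v` is put into the local memory of processor `q`. -/
def PebbleConfig.addRed {p : ℕ} {V : Type*} (c : PebbleConfig p V) (q : Fin p) (v : V) :
    PebbleConfig p V :=
  { c with red := Function.update c.red q (insert v (c.red q)) }

/-- The effect of a move on a configuration. -/
def PebbleConfig.apply {p : ℕ} {V : Type*} (c : PebbleConfig p V) :
    PebbleMove p V → PebbleConfig p V
  | .load q v => c.addRed q v
  | .store _ v => { c with blue := insert v c.blue }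
  | .send _ r v => c.addRed r v
  | .compute q v => c.addRed q v
  | .freeRed q v => { c with red := Function.update c.red q (c.red q \ {v}) }
  | .freeBlue v => { c with blue := c.blue \ {v} }

/-- The rules of the game. Inputs cannot be computed: they have to be loaded or received. -/
def CDAG.Allowed {p : ℕ} {V : Type*} (G : CDAG V) (c : PebbleConfig p V) : PebbleMove p V → Prop
  | .load _ v => v ∈ c.blue
  | .store q v => v ∈ c.red q
  | .send q r v => q ≠ r ∧ v ∈ c.red q
  | .compute q v => v ∉ G.inputs ∧ ∀ u, G.Adj u v → u ∈ c.red q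
  | .freeRed _ _ => True
  | .freeBlue _ => True

/-- Starting from the configuration `c`, every move of the list is allowed, and no local memory
ever holds more than `S` values. -/
def CDAG.IsRun {p : ℕ} {V : Type*} (G : CDAG V) (S : ℕ) :
    PebbleConfig p V → List (PebbleMove p V) → Prop
  | _, [] => True
  | c, x :: σ =>
      G.Allowed c x ∧ (∀ q, ((c.apply x).red q).encard ≤ S) ∧ CDAG.IsRun G S (c.apply x) σ

/-- The initial configuration: the inputs are in the slow memory, the local memories are empty. -/
def CDAG.initial {V : Type*} (G : CDAG V) (p : ℕ) : PebbleConfig p V where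
  red := fun _ => ∅
  blue := G.inputs

/-- A complete calculation of `G` on `p` processors with local memories of size `S`: a sequence of
allowed moves that leads from the initial configuration to one in which all outputs are in the slow
memory. (Superfluous pebbles can be removed by moves that cost nothing.) -/
def CDAG.IsCompleteCalculation {p : ℕ} {V : Type*} (G : CDAG V) (S : ℕ)
    (σ : List (PebbleMove p V)) : Prop :=
  G.IsRun S (G.initial p) σ ∧ G.outputs ⊆ (σ.foldl PebbleConfig.apply (G.initial p)).blue

/-- The number of words that a move brings into or takes out of the local memory of processor
`q`. -/
def PebbleMove.io {p : ℕ} {V : Type*} (q : Fin p) : PebbleMove p V → ℕ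
  | .load r _ => if r = q then 1 else 0
  | .store r _ => if r = q then 1 else 0
  | .send r s _ => if r = q ∨ s = q then 1 else 0
  | .compute _ _ => 0
  | .freeRed _ _ => 0
  | .freeBlue _ => 0

/-- The I/O cost of processor `q` in a calculation: the number of words transferred into or out of
its local memory. -/
def ioCost {p : ℕ} {V : Type*} (σ : List (PebbleMove p V)) (q : Fin p) : ℕ :=
  (σ.map (PebbleMove.io q)).sum

/-- The local domain of processor `q`: the set of vertices that it computes. -/
def localDomain {p : ℕ} {V : Type*} (σ : List (PebbleMove p V)) (q : Fin p) : Set V :=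
  {v | PebbleMove.compute q v ∈ σ}

/-- The vertices of the CDAG of `C = A B`, where `A` is `m × k` and `B` is `k × n`: the entries of
`A`, the entries of `B`, and the `mnk` partial sums of the entries of `C`. -/
inductive MMMVertex (m n k : ℕ) where
  | a (i : Fin m) (t : Fin k)
  | b (t : Fin k) (j : Fin n)
  | c (i : Fin m) (j : Fin n) (t : Fin k)

/-- The edges of the CDAG of classical matrix multiplication, whose elementary operations are
`C(i,j,t) = C(i,j,t-1) + A(i,t) * B(t,j)`, without the term `C(i,j,t-1)` for the first `t`. -/
inductive MMMVertex.Edge {m n k : ℕ} : MMMVertex m n k → MMMVertex m n k → Prop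
  | fromA (i : Fin m) (j : Fin n) (t : Fin k) : Edge (.a i t) (.c i j t)
  | fromB (i : Fin m) (j : Fin n) (t : Fin k) : Edge (.b t j) (.c i j t)
  | fromC (i : Fin m) (j : Fin n) (s t : Fin k) (h : s.val + 1 = t.val) :
      Edge (.c i j s) (.c i j t)

/-- The depth of a vertex along the summation index; it increases along every edge. -/
def MMMVertex.level {m n k : ℕ} : MMMVertex m n k → ℕ
  | .a _ _ => 0
  | .b _ _ => 0
  | .c _ _ t => t.val + 1

theorem MMMVertex.Edge.level_lt {m n k : ℕ} {u v : MMMVertex m n k} (h : u.Edge v) :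
    u.level < v.level := by
  cases h with
  | fromA i j t => simp [MMMVertex.level]
  | fromB i j t => simp [MMMVertex.level]
  | fromC i j s t h => simp only [MMMVertex.level]; omega

/-- The CDAG of classical matrix multiplication. -/
def mmmCDAG (m n k : ℕ) : CDAG (MMMVertex m n k) where
  Adj := MMMVertex.Edge
  acyclic := fun v h => by
    have key : ∀ w, Relation.TransGen MMMVertex.Edge v w → v.level < w.level := by
      intro w hw
      induction hw with
      | single h => exact h.level_lt
      | tail _ h ih => exact ih.trans h.level_lt
    exact lt_irrefl _ (key v h)

/-!
Write `w = mnk / p`. For `S > 0` the inequality of the arithmetic and geometric means gives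
`w / √S + w / √S + S ≥ 3 w ^ (2/3)`, so the second term of the minimum is at most the first. It is a lower
bound on the I/O of any processor that is responsible for `w` partial sums.

Every output `C(i,j,k)` in the slow memory at the end has a history: it was computed somewhere,
from a value `C(i,j,k-1)` that was computed somewhere, and so on. Following this history backwards
assigns to each partial sum an *owner*, a processor that computes it, in such a way that a partial
sum leaves the memory of its owner unless the next one has the same owner; the last one leaves it
in any case. This takes care of recomputation: computations that contribute to no output are
ignored. The invariant `IsTraced`, preserved by each move (`IsTraced.apply`), yields the owners
(`exists_isOwner`).

Let `D` be the set of triples `(i,j,t)` owned by `q`. Then `q` transfers every `A(i,t)` and every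
`B(t,j)` in the projections of `D`, and for every `(i,j)` in the third projection it transfers the
last `C(i,j,t)` that it owns. These words are distinct, so the I/O cost of `q` is at least
the sum of the sizes of the three projections (`IsOwner.card_projections_le_ioCost`). By the
Loomis–Whitney inequality (`sq_card_le_mul_card_image`) the product of these sizes is at least
`|D| ^ 2`, so by the inequality of the arithmetic and geometric means the sum is at least
`3 |D| ^ (2/3)`.

The owners partition the `mnk` triples, so some `D` has at least `w` elements. In a load balanced
execution each `D` has at most `w` elements, because owned vertices are computed; hence each has
exactly `w`.
-/

/-! ### Transferred words -/

/-- The value that a move is about. -/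
def PebbleMove.word {p : ℕ} {V : Type*} : PebbleMove p V → V
  | .load _ v => v
  | .store _ v => v
  | .send _ _ v => v
  | .compute _ v => v
  | .freeRed _ v => v
  | .freeBlue v => v

/-- The value `v` is transferred, in some move of `σ`, into or out of the local memory of `q`. -/
def Transfers {p : ℕ} {V : Type*} (σ : List (PebbleMove p V)) (q : Fin p) (v : V) : Prop :=
  ∃ x ∈ σ, x.io q = 1 ∧ x.word = v

/-- The I/O cost of `q` is at least the number of distinct values that `q` transfers. -/
theorem card_le_ioCost {p : ℕ} {V : Type*} (q : Fin p) (σ : List (PebbleMove p V))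
    (T : Finset V) (hT : ∀ v ∈ T, Transfers σ q v) : T.card ≤ ioCost σ q := by
  classical
  induction σ generalizing T with
  | nil =>
    have : T = ∅ := Finset.eq_empty_of_forall_notMem fun v hv => by
      obtain ⟨x, hx, -⟩ := hT v hv
      simp at hx
    simp [this]
  | cons y σ ih =>
    have hcost : ioCost (y :: σ) q = y.io q + ioCost σ q := by simp [ioCost]
    rw [hcost]
    by_cases hy : y.io q = 1
    · have h := ih (T.erase y.word) fun v hv => by
        obtain ⟨hne, hv⟩ := Finset.mem_erase.1 hv
        obtain ⟨x, hx, hio, rfl⟩ := hT v hv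
        rcases List.mem_cons.1 hx with rfl | hx
        · exact absurd rfl hne
        · exact ⟨x, hx, hio, rfl⟩
      have := Finset.pred_card_le_card_erase (a := y.word) (s := T)
      omega
    · have h := ih T fun v hv => by
        obtain ⟨x, hx, hio, rfl⟩ := hT v hv
        rcases List.mem_cons.1 hx with rfl | hx
        · exact absurd hio hy
        · exact ⟨x, hx, hio, rfl⟩
      omega

theorem transfers_of_load {p : ℕ} {V : Type*} {σ : List (PebbleMove p V)} {q : Fin p} {v : V}
    (h : .load q v ∈ σ) : Transfers σ q v :=
  ⟨_, h, by simp [PebbleMove.io], rfl⟩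

theorem transfers_of_store {p : ℕ} {V : Type*} {σ : List (PebbleMove p V)} {q : Fin p} {v : V}
    (h : .store q v ∈ σ) : Transfers σ q v :=
  ⟨_, h, by simp [PebbleMove.io], rfl⟩

theorem transfers_of_send_left {p : ℕ} {V : Type*} {σ : List (PebbleMove p V)} {q r : Fin p}
    {v : V} (h : .send q r v ∈ σ) : Transfers σ q v :=
  ⟨_, h, by simp [PebbleMove.io], rfl⟩

theorem transfers_of_send_right {p : ℕ} {V : Type*} {σ : List (PebbleMove p V)} {q r : Fin p}
    {v : V} (h : .send q r v ∈ σ) : Transfers σ r v :=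
  ⟨_, h, by simp [PebbleMove.io], rfl⟩

/-- A value enters a local memory by a transfer or by a computation. -/
theorem PebbleConfig.mem_red_apply {p : ℕ} {V : Type*} {c : PebbleConfig p V}
    {x : PebbleMove p V} {q : Fin p} {v : V} (h : v ∈ (c.apply x).red q) :
    v ∈ c.red q ∨ x = .load q v ∨ (∃ r, x = .send r q v) ∨ x = .compute q v := by
  have add : ∀ (r : Fin p) (u : V), v ∈ (c.addRed r u).red q → v ∈ c.red q ∨ r = q ∧ u = v := by
    intro r u hv
    by_cases hr : q = r
    · subst hr
      simp only [PebbleConfig.addRed, Function.update_self, Set.mem_insert_iff] at hv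
      tauto
    · simp only [PebbleConfig.addRed, Function.update_of_ne hr] at hv
      exact .inl hv
  cases x with
  | load r u => rcases add r u h with h | ⟨rfl, rfl⟩ <;> simp [*]
  | store r u => exact .inl h
  | send r s u => rcases add s u h with h | ⟨rfl, rfl⟩ <;> simp [*]
  | compute r u => rcases add r u h with h | ⟨rfl, rfl⟩ <;> simp [*]
  | freeRed r u =>
    left
    by_cases hr : q = r
    · subst hr
      simp only [PebbleConfig.apply, Function.update_self] at h
      exact h.1
    · simpa only [PebbleConfig.apply, Function.update_of_ne hr] using h
  | freeBlue u => exact .inl h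

theorem PebbleConfig.mem_blue_apply {p : ℕ} {V : Type*} {c : PebbleConfig p V}
    {x : PebbleMove p V} {v : V} (h : v ∈ (c.apply x).blue) :
    v ∈ c.blue ∨ ∃ q, x = .store q v := by
  cases x with
  | store r u =>
    rcases h with rfl | h
    · exact .inr ⟨r, rfl⟩
    · exact .inl h
  | freeBlue u => exact .inl h.1
  | _ => exact .inl h

/-! ### Owners of the partial sums -/

/-- `o s` is, for each `s ≤ t`, a processor that computes the partial sum `C(i,j,s)` and transfers
the two input operands; it also transfers `C(i,j,s)` itself if `s < t` and the next partial
sum has another owner. The values `o s` for `s > t` are irrelevant. -/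
structure IsHistory {m n k p : ℕ} (σ : List (PebbleMove p (MMMVertex m n k))) (i : Fin m)
    (j : Fin n) (t : Fin k) (o : Fin k → Fin p) : Prop where
  computes : ∀ s ≤ t, .compute (o s) (.c i j s) ∈ σ
  transfers_a : ∀ s ≤ t, Transfers σ (o s) (.a i s)
  transfers_b : ∀ s ≤ t, Transfers σ (o s) (.b s j)
  eq_or_transfers : ∀ s s' : Fin k, s.val + 1 = s'.val → s' ≤ t →
    o s = o s' ∨ Transfers σ (o s) (.c i j s)

/-- The invariant of the game. The list `σ` of moves is that of the whole execution, not just of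
the moves before the configuration `c`. -/
structure IsTraced {m n k p : ℕ} (σ : List (PebbleMove p (MMMVertex m n k)))
    (c : PebbleConfig p (MMMVertex m n k)) : Prop where
  red_a : ∀ q i t, .a i t ∈ c.red q → Transfers σ q (.a i t)
  red_b : ∀ q t j, .b t j ∈ c.red q → Transfers σ q (.b t j)
  red_c : ∀ q i j t, .c i j t ∈ c.red q →
    ∃ o, IsHistory σ i j t o ∧ (o t = q ∨ Transfers σ (o t) (.c i j t))
  blue_c : ∀ i j t, .c i j t ∈ c.blue →
    ∃ o, IsHistory σ i j t o ∧ Transfers σ (o t) (.c i j t)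

theorem c_notMem_inputs {m n k : ℕ} (i : Fin m) (j : Fin n) (t : Fin k) :
    .c i j t ∉ (mmmCDAG m n k).inputs :=
  fun h => h _ (.fromA i j t)

theorem isTraced_initial {m n k p : ℕ} (σ : List (PebbleMove p (MMMVertex m n k))) :
    IsTraced σ ((mmmCDAG m n k).initial p) where
  red_a _ _ _ h := h.elim
  red_b _ _ _ h := h.elim
  red_c _ _ _ _ h := h.elim
  blue_c i j t h := (c_notMem_inputs i j t h).elim

/-- A computation of `C(i,j,t)` extends the history of its operand `C(i,j,t-1)`. -/
theorem IsTraced.exists_isHistory_of_compute {m n k p : ℕ}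
    {σ : List (PebbleMove p (MMMVertex m n k))} {c : PebbleConfig p (MMMVertex m n k)}
    (hc : IsTraced σ c) {q : Fin p} {i : Fin m} {j : Fin n} {t : Fin k}
    (hmem : .compute q (.c i j t) ∈ σ)
    (hops : ∀ u, (mmmCDAG m n k).Adj u (.c i j t) → u ∈ c.red q) :
    ∃ o, IsHistory σ i j t o ∧ o t = q := by
  have ha : Transfers σ q (.a i t) := hc.red_a q i t (hops _ (.fromA i j t))
  have hb : Transfers σ q (.b t j) := hc.red_b q t j (hops _ (.fromB i j t))
  rcases Nat.eq_zero_or_pos t.val with ht | ht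
  · have hs : ∀ s ≤ t, s = t := fun s hs => Fin.ext (by have := Fin.le_def.1 hs; omega)
    refine ⟨fun _ => q, ⟨?_, ?_, ?_, fun _ _ _ _ => .inl rfl⟩, rfl⟩
    · intro s h; rwa [hs s h]
    · intro s h; rwa [hs s h]
    · intro s h; rwa [hs s h]
  · let r : Fin k := ⟨t.val - 1, by omega⟩
    have hr : r.val + 1 = t.val := by simp only [r]; omega
    obtain ⟨o, ho, hor⟩ := hc.red_c q i j r (hops _ (.fromC i j r t hr))
    have hs : ∀ s ≤ t, s ≠ t → s ≤ r := fun s h h' => by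
      have h1 := Fin.le_def.1 h
      have h2 := Fin.val_ne_of_ne h'
      exact Fin.le_def.2 (by omega)
    refine ⟨Function.update o t q, ⟨?_, ?_, ?_, ?_⟩, Function.update_self ..⟩
    · intro s h
      by_cases hst : s = t
      · subst hst; simpa using hmem
      · simpa [Function.update_of_ne hst] using ho.computes s (hs s h hst)
    · intro s h
      by_cases hst : s = t
      · subst hst; simpa using ha
      · simpa [Function.update_of_ne hst] using ho.transfers_a s (hs s h hst)
    · intro s h
      by_cases hst : s = t
      · subst hst; simpa using hb
      · simpa [Function.update_of_ne hst] using ho.transfers_b s (hs s h hst)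
    · intro s s' hss h
      have hst : s ≠ t := fun e => by
        have := Fin.le_def.1 h
        rw [e] at hss
        omega
      rw [Function.update_of_ne hst]
      by_cases hst' : s' = t
      · have hsr : s = r := Fin.ext (by rw [hst'] at hss; omega)
        rw [hst', Function.update_self, hsr]
        exact hor
      · rw [Function.update_of_ne hst']
        exact ho.eq_or_transfers s s' hss (hs s' h hst')

theorem IsTraced.apply {m n k p : ℕ} {σ : List (PebbleMove p (MMMVertex m n k))}
    {c : PebbleConfig p (MMMVertex m n k)} (hc : IsTraced σ c)
    {x : PebbleMove p (MMMVertex m n k)} (hx : x ∈ σ) (hal : (mmmCDAG m n k).Allowed c x) :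
    IsTraced σ (c.apply x) where
  red_a q i t h := by
    rcases PebbleConfig.mem_red_apply h with h | rfl | ⟨r, rfl⟩ | rfl
    · exact hc.red_a q i t h
    · exact transfers_of_load hx
    · exact transfers_of_send_right hx
    · exact (hal.1 fun u hu => by cases hu).elim
  red_b q t j h := by
    rcases PebbleConfig.mem_red_apply h with h | rfl | ⟨r, rfl⟩ | rfl
    · exact hc.red_b q t j h
    · exact transfers_of_load hx
    · exact transfers_of_send_right hx
    · exact (hal.1 fun u hu => by cases hu).elim
  red_c q i j t h := by
    rcases PebbleConfig.mem_red_apply h with h | rfl | ⟨r, rfl⟩ | rfl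
    · exact hc.red_c q i j t h
    · obtain ⟨o, ho, ht⟩ := hc.blue_c i j t hal
      exact ⟨o, ho, .inr ht⟩
    · obtain ⟨o, ho, rfl | ht⟩ := hc.red_c r i j t hal.2
      · exact ⟨o, ho, .inr (transfers_of_send_left hx)⟩
      · exact ⟨o, ho, .inr ht⟩
    · obtain ⟨o, ho, ht⟩ := hc.exists_isHistory_of_compute hx hal.2
      exact ⟨o, ho, .inl ht⟩
  blue_c i j t h := by
    rcases PebbleConfig.mem_blue_apply h with h | ⟨q, rfl⟩
    · exact hc.blue_c i j t h
    · obtain ⟨o, ho, rfl | ht⟩ := hc.red_c q i j t hal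
      · exact ⟨o, ho, transfers_of_store hx⟩
      · exact ⟨o, ho, ht⟩

theorem IsTraced.foldl {m n k p S : ℕ} {σ τ : List (PebbleMove p (MMMVertex m n k))}
    {c : PebbleConfig p (MMMVertex m n k)} (hc : IsTraced σ c)
    (hrun : (mmmCDAG m n k).IsRun S c τ) (hsub : ∀ x ∈ τ, x ∈ σ) :
    IsTraced σ (τ.foldl PebbleConfig.apply c) := by
  induction τ generalizing c with
  | nil => exact hc
  | cons x τ ih =>
    obtain ⟨hal, -, hrun⟩ := hrun
    exact ih (hc.apply (hsub x (by simp)) hal) hrun fun y hy => hsub y (by simp [hy])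

/-- An assignment of the partial sums to processors in which the owner of a partial sum computes
it and transfers the two input operands, and a processor that owns a partial sum of an entry of
`C` transfers some partial sum of the same entry. -/
structure IsOwner {m n k p : ℕ} (σ : List (PebbleMove p (MMMVertex m n k)))
    (o : Fin m × Fin n × Fin k → Fin p) : Prop where
  computes : ∀ i j t, .compute (o (i, j, t)) (.c i j t) ∈ σ
  transfers_a : ∀ i j t, Transfers σ (o (i, j, t)) (.a i t)
  transfers_b : ∀ i j t, Transfers σ (o (i, j, t)) (.b t j)
  transfers_c : ∀ i j t, ∃ s, Transfers σ (o (i, j, t)) (.c i j s)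

theorem exists_isOwner {m n k p S : ℕ} {σ : List (PebbleMove p (MMMVertex m n k))}
    (hσ : (mmmCDAG m n k).IsCompleteCalculation S σ) : ∃ o, IsOwner σ o := by
  have hfin := (isTraced_initial σ).foldl hσ.1 fun _ h => h
  rcases Nat.eq_zero_or_pos k with rfl | hk
  · exact ⟨fun x => x.2.2.elim0, fun _ _ t => t.elim0, fun _ _ t => t.elim0,
      fun _ _ t => t.elim0, fun _ _ t => t.elim0⟩
  let l : Fin k := ⟨k - 1, by omega⟩
  have hl : ∀ s : Fin k, s ≤ l := fun s => Fin.le_def.2 (by simp only [l]; omega)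
  have hex : ∀ (i : Fin m) (j : Fin n),
      ∃ o, IsHistory σ i j l o ∧ Transfers σ (o l) (.c i j l) := by
    refine fun i j => hfin.blue_c i j l (hσ.2 fun w hw => ?_)
    cases hw with
    | fromC _ _ _ t h => have := t.isLt; simp only [l] at h; omega
  choose o ho hlast using hex
  refine ⟨fun x => o x.1 x.2.1 x.2.2, fun i j t => (ho i j).computes t (hl t),
    fun i j t => (ho i j).transfers_a t (hl t), fun i j t => (ho i j).transfers_b t (hl t),
    fun i j t => ?_⟩
  -- The partial sum that is transferred is the last one with the same owner as `C(i,j,t)`.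
  obtain ⟨s, hs, hmax⟩ := Finset.exists_max_image
    (Finset.univ.filter fun s => o i j s = o i j t) id ⟨t, by simp⟩
  simp only [Finset.mem_filter, Finset.mem_univ, true_and, id] at hs hmax
  refine ⟨s, ?_⟩
  change Transfers σ (o i j t) _
  rw [← hs]
  by_cases hsl : s = l
  · rw [hsl]
    exact hlast i j
  · have hlt : s.val + 1 < k := by
      have h1 := Fin.val_ne_of_ne hsl
      have h2 := s.isLt
      simp only [l] at h1
      omega
    rcases (ho i j).eq_or_transfers s ⟨s.val + 1, hlt⟩ rfl (hl _) with h | h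
    · have := Fin.le_def.1 (hmax ⟨s.val + 1, hlt⟩ (h.symm.trans hs))
      simp at this
    · exact h

/-! ### The Loomis–Whitney inequality -/

/-- The discrete Loomis–Whitney inequality in three dimensions: the square of the number of points
is at most the product of the sizes of the coordinate projections. -/
theorem sq_card_le_mul_card_image {α β γ : Type*} [DecidableEq α] [DecidableEq β]
    [DecidableEq γ] (D : Finset (α × β × γ)) :
    D.card ^ 2 ≤ (D.image fun x => (x.1, x.2.2)).card * (D.image fun x => (x.2.2, x.2.1)).card *
      (D.image fun x => (x.1, x.2.1)).card := by
  set C := D.image fun x => (x.1, x.2.1) with hC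
  let F : α × β → Finset (α × β × γ) := fun y => D.filter fun x => (x.1, x.2.1) = y
  have hcard : D.card = ∑ y ∈ C, (F y).card :=
    Finset.card_eq_sum_card_fiberwise fun x hx => Finset.mem_image_of_mem _ hx
  -- A pair of points with the same first two coordinates `(a, b)` and third coordinates `c`, `c'`
  -- is determined by `(a, c)` and `(c', b)`.
  have hpairs : ∑ y ∈ C, (F y).card ^ 2 ≤
      (D.image fun x => (x.1, x.2.2)).card * (D.image fun x => (x.2.2, x.2.1)).card := by
    have : ∑ y ∈ C, (F y).card ^ 2 = (C.sigma fun y => F y ×ˢ F y).card := by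
      rw [Finset.card_sigma]
      exact Finset.sum_congr rfl fun y _ => by rw [Finset.card_product, sq]
    rw [this, ← Finset.card_product]
    refine Finset.card_le_card_of_injOn
      (fun z => ((z.2.1.1, z.2.1.2.2), (z.2.2.2.2, z.2.2.2.1))) ?_ ?_
    · rintro ⟨y, x, x'⟩ h
      simp only [Finset.coe_sigma, Set.mem_sigma_iff, Finset.mem_coe, Finset.mem_product, F,
        Finset.mem_filter] at h
      exact Finset.mem_coe.2 (Finset.mem_product.2
        ⟨Finset.mem_image_of_mem (fun x : α × β × γ => (x.1, x.2.2)) h.2.1.1,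
          Finset.mem_image_of_mem (fun x : α × β × γ => (x.2.2, x.2.1)) h.2.2.1⟩)
    · rintro ⟨⟨a, b⟩, ⟨a₁, b₁, c₁⟩, ⟨a₂, b₂, c₂⟩⟩ h ⟨⟨a', b'⟩, ⟨a₁', b₁', c₁'⟩, ⟨a₂', b₂', c₂'⟩⟩ h' e
      simp only [Finset.coe_sigma, Set.mem_sigma_iff, Finset.mem_coe, Finset.mem_product, F,
        Finset.mem_filter, Prod.mk.injEq] at h h' e
      obtain ⟨-, ⟨-, rfl, rfl⟩, -, rfl, rfl⟩ := h
      obtain ⟨-, ⟨-, rfl, rfl⟩, -, rfl, rfl⟩ := h'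
      obtain ⟨⟨rfl, rfl⟩, rfl, rfl⟩ := e
      rfl
  calc D.card ^ 2 = (∑ y ∈ C, (F y).card) ^ 2 := by rw [hcard]
    _ ≤ C.card * ∑ y ∈ C, (F y).card ^ 2 := sq_sum_le_card_mul_sum_sq
    _ ≤ C.card * _ := Nat.mul_le_mul_left _ hpairs
    _ = _ := Nat.mul_comm _ _

theorem three_mul_rpow_two_thirds_le_add {w a b c : ℝ} (hw : 0 ≤ w) (ha : 0 ≤ a) (hb : 0 ≤ b)
    (hc : 0 ≤ c) (h : w ^ 2 ≤ a * b * c) : 3 * w ^ ((2 : ℝ) / 3) ≤ a + b + c := by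
  have hcube : (w ^ ((2 : ℝ) / 3)) ^ 3 = w ^ 2 := by
    rw [← Real.rpow_natCast, ← Real.rpow_mul hw, ← Real.rpow_natCast]
    norm_num
  have amgm : 27 * (a * b * c) ≤ (a + b + c) ^ 3 := by
    nlinarith [mul_nonneg ha (sq_nonneg (b - c)), mul_nonneg hb (sq_nonneg (a - c)),
      mul_nonneg hc (sq_nonneg (a - b)), mul_nonneg ha (sq_nonneg (a - b)),
      mul_nonneg ha (sq_nonneg (a - c)), mul_nonneg hb (sq_nonneg (b - c)),
      mul_nonneg hb (sq_nonneg (a - b)), mul_nonneg hc (sq_nonneg (a - c)),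
      mul_nonneg hc (sq_nonneg (b - c))]
  refine le_of_pow_le_pow_left₀ (n := 3) (by norm_num) (by positivity) ?_
  rw [mul_pow, hcube]
  linarith

/-! ### The I/O cost of an owner -/

/-- A processor transfers at least one word for each point of the three coordinate projections of
the set of partial sums that it owns. -/
theorem IsOwner.card_projections_le_ioCost {m n k p : ℕ}
    {σ : List (PebbleMove p (MMMVertex m n k))} {o : Fin m × Fin n × Fin k → Fin p}
    (ho : IsOwner σ o) (q : Fin p) {D : Finset (Fin m × Fin n × Fin k)}
    (hD : ∀ x ∈ D, o x = q) :
    (D.image fun x => (x.1, x.2.2)).card + (D.image fun x => (x.2.2, x.2.1)).card +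
      (D.image fun x => (x.1, x.2.1)).card ≤ ioCost σ q := by
  classical
  choose s hs using ho.transfers_c
  let A := D.image fun x => (x.1, x.2.2)
  let B := D.image fun x => (x.2.2, x.2.1)
  let W := D.image fun x => (x.1, x.2.1, s x.1 x.2.1 x.2.2)
  let word : (Fin m × Fin k) ⊕ (Fin k × Fin n) ⊕ (Fin m × Fin n × Fin k) → MMMVertex m n k :=
    Sum.elim (fun y => .a y.1 y.2) (Sum.elim (fun y => .b y.1 y.2) fun y => .c y.1 y.2.1 y.2.2)
  have hinj : Function.Injective word := by
    rintro (⟨_, _⟩ | ⟨_, _⟩ | ⟨_, _, _⟩) (⟨_, _⟩ | ⟨_, _⟩ | ⟨_, _, _⟩) h <;> cases h <;> rfl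
  have hC : (D.image fun x => (x.1, x.2.1)).card ≤ W.card := by
    have : D.image (fun x => (x.1, x.2.1)) = W.image fun x => (x.1, x.2.1) := by
      rw [Finset.image_image]
      rfl
    rw [this]
    exact Finset.card_image_le
  calc A.card + B.card + (D.image fun x => (x.1, x.2.1)).card
      ≤ A.card + (B.card + W.card) := by omega
    _ = ((A.disjSum (B.disjSum W)).image word).card := by
        rw [Finset.card_image_of_injective _ hinj, Finset.card_disjSum, Finset.card_disjSum]
    _ ≤ ioCost σ q := card_le_ioCost q σ _ fun v hv => by
        obtain ⟨y, hy, rfl⟩ := Finset.mem_image.1 hv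
        rcases y with y | y | y
        · obtain ⟨x, hx, rfl⟩ := Finset.mem_image.1 (Finset.inl_mem_disjSum.1 hy)
          exact hD x hx ▸ ho.transfers_a x.1 x.2.1 x.2.2
        · obtain ⟨x, hx, rfl⟩ := Finset.mem_image.1
            (Finset.inl_mem_disjSum.1 (Finset.inr_mem_disjSum.1 hy))
          exact hD x hx ▸ ho.transfers_b x.1 x.2.1 x.2.2
        · obtain ⟨x, hx, rfl⟩ := Finset.mem_image.1
            (Finset.inr_mem_disjSum.1 (Finset.inr_mem_disjSum.1 hy))
          exact hD x hx ▸ hs x.1 x.2.1 x.2.2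

theorem IsOwner.three_mul_rpow_le_ioCost {m n k p : ℕ}
    {σ : List (PebbleMove p (MMMVertex m n k))} {o : Fin m × Fin n × Fin k → Fin p}
    (ho : IsOwner σ o) (q : Fin p) {w : ℝ} (hw : 0 ≤ w)
    (h : w ≤ ((Finset.univ.filter fun x => o x = q).card : ℝ)) :
    3 * w ^ ((2 : ℝ) / 3) ≤ (ioCost σ q : ℝ) := by
  set D := Finset.univ.filter fun x => o x = q with hD
  have hsum := ho.card_projections_le_ioCost q (D := D) fun x hx => (Finset.mem_filter.1 hx).2
  have hprod : w ^ 2 ≤ ((D.image fun x => (x.1, x.2.2)).card : ℝ) *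
      (D.image fun x => (x.2.2, x.2.1)).card * (D.image fun x => (x.1, x.2.1)).card :=
    (pow_le_pow_left₀ hw h 2).trans (mod_cast sq_card_le_mul_card_image D)
  refine (three_mul_rpow_two_thirds_le_add hw (Nat.cast_nonneg _) (Nat.cast_nonneg _)
    (Nat.cast_nonneg _) hprod).trans ?_
  exact_mod_cast hsum

theorem IsOwner.card_le_ncard_localDomain {m n k p : ℕ}
    {σ : List (PebbleMove p (MMMVertex m n k))} {o : Fin m × Fin n × Fin k → Fin p}
    (ho : IsOwner σ o) (q : Fin p) :
    (Finset.univ.filter fun x => o x = q).card ≤ (localDomain σ q).ncard := by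
  have hfin : (localDomain σ q).Finite :=
    (σ.finite_toSet.image PebbleMove.word).subset fun v hv => ⟨_, hv, rfl⟩
  rw [← Set.ncard_coe_finset]
  refine Set.ncard_le_ncard_of_injOn (fun x => .c x.1 x.2.1 x.2.2) ?_ ?_ hfin
  · rintro ⟨i, j, t⟩ hx
    have hq : o (i, j, t) = q := by simpa using hx
    exact hq ▸ ho.computes i j t
  · rintro ⟨i, j, t⟩ - ⟨i', j', t'⟩ - h
    cases h
    rfl

theorem theorem2 (m n k p S : ℕ) (hp : 0 < p)
    (hS : ((m : ℝ) * n + m * k + n * k) / p ≤ S)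
    (σ : List (PebbleMove p (MMMVertex m n k)))
    (hσ : (mmmCDAG m n k).IsCompleteCalculation S σ) :
    (∃ q : Fin p,
      min (2 * ((m : ℝ) * n * k) / (p * √(S : ℝ)) + S)
        (3 * (((m : ℝ) * n * k) / p) ^ ((2 : ℝ) / 3)) ≤ (ioCost σ q : ℝ)) ∧
    ((∀ q : Fin p, ((localDomain σ q).ncard : ℝ) = ((m : ℝ) * n * k) / p) →
      ∀ q : Fin p,
        min (2 * ((m : ℝ) * n * k) / (p * √(S : ℝ)) + S)
          (3 * (((m : ℝ) * n * k) / p) ^ ((2 : ℝ) / 3)) ≤ (ioCost σ q : ℝ)) := by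
  obtain ⟨o, ho⟩ := exists_isOwner hσ
  have hp' : (0 : ℝ) < p := by exact_mod_cast hp
  set w : ℝ := ((m : ℝ) * n * k) / p with hw
  have hw0 : 0 ≤ w := by positivity
  have hsum : ∑ q : Fin p, ((Finset.univ.filter fun x => o x = q).card : ℝ) =
      ∑ _q : Fin p, w := by
    have : ∑ q : Fin p, (Finset.univ.filter fun x => o x = q).card = m * n * k := by
      rw [← Finset.card_eq_sum_card_fiberwise fun x _ => Finset.mem_coe.2 (Finset.mem_univ (o x))]
      simp [mul_assoc]
    rw [← Nat.cast_sum, this, Finset.sum_const, Finset.card_univ, Fintype.card_fin, nsmul_eq_mul,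
      hw, mul_div_cancel₀ _ hp'.ne']
    push_cast
    ring
  refine ⟨?_, fun hbal q => ?_⟩
  · have : (Finset.univ : Finset (Fin p)).Nonempty := ⟨⟨0, hp⟩, Finset.mem_univ _⟩
    obtain ⟨q, -, hq⟩ := Finset.exists_le_of_sum_le this hsum.ge
    exact ⟨q, (min_le_right _ _).trans (ho.three_mul_rpow_le_ioCost q hw0 hq)⟩
  · have hle : ∀ q ∈ Finset.univ,
        ((Finset.univ.filter fun x => o x = q).card : ℝ) ≤ w := fun q _ => by
      rw [← hbal q]
      exact_mod_cast ho.card_le_ncard_localDomain q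
    have heq := (Finset.sum_eq_sum_iff_of_le hle).1 hsum q (Finset.mem_univ q)
    exact (min_le_right _ _).trans (ho.three_mul_rpow_le_ioCost q hw0 heq.ge)
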